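/- Let $b \ge 2$ be an integer. For a positive integer $n = \sum_{0\le i<N} n_i b^i$ with $0 \le n_i < b$ and $n_{N-1} \ne 0$, let $\overleftarrow{n} = \sum_{0 \le i < N} n_i b^{N-1-i}$ be its base-$b$ digital reverse, and call $n$ a base-$b$ palindrome if $b \nmid n$ and $n = \overleftarrow{n}$. For real $x, D > 0$ let $$\mathscr{P}_b^*(x) = \{ n \le x : n \text{ is a base-}b\text{ palindrome and } \gcd(n, b^3-b) = 1 \},$$ $$S_b(x,D) = \#\{ n \in \mathscr{P}_b^*(x) : d^2 \mid n \text{ for some integer } d \in [D, 2D] \}.$$ (a) For every $\varepsilon > 0$ there is a constant $C = C(b,\varepsilon)$ such that, for all real $x > 0$ and $D$ with $x^{3/13} \le D \le x^{8/31-\varepsilon}$, $$S_b(x,D) \le C\, \frac{x^{7/11}}{D^{13/22-\varepsilon}}.$$ (b) In particular, for every $\varepsilon \in (0, 0.1)$ there is a constant $C = C(b,\varepsilon)$ such that, for all real $x > 0$ and $D$ with $x^{3/13+3\varepsilon} \le D \le x^{8/31-\varepsilon}$, $$S_b(x,D) \le C\, x^{1/2-\varepsilon}.$$ -/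

import Mathlib

/-- The base-`b` digital reverse of `n`: if `n = ∑_{i<N} n_i b^i` has the digits `n_0, …, n_{N-1}`
(least significant first), this is `∑_{i<N} n_i b^(N-1-i)`. -/
def digitalReverse (b n : ℕ) : ℕ :=
  Nat.ofDigits b (Nat.digits b n).reverse

/-- The set of base-`b` palindromes: `b ∤ n` and `n` equals its digital reverse. -/
def basePalindromes (b : ℕ) : Set ℕ :=
  {n | ¬ b ∣ n ∧ n = digitalReverse b n}

/-- The base-`b` palindromes `n ≤ x` with `(n, b^3 - b) = 1`. -/
def coprimePalindromesUpTo (b : ℕ) (x : ℝ) : Set ℕ :=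
  {n | n ∈ basePalindromes b ∧ (n : ℝ) ≤ x ∧ Nat.Coprime n (b ^ 3 - b)}

theorem coprimePalindromesUpTo_finite (b : ℕ) (x : ℝ) :
    (coprimePalindromesUpTo b x).Finite :=
  (Set.finite_Iic ⌊x⌋₊).subset fun _ hn => Nat.le_floor hn.2.1

/-- `S_b(x, D)`: the number of palindromes `n` as above that are divisible by `d^2` for some
integer `d` in `[D, 2D]`. The set being counted is finite. -/
noncomputable def palindromeSquareCount (b : ℕ) (x D : ℝ) : ℕ :=
  Set.ncard {n | n ∈ coprimePalindromesUpTo b x ∧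
    ∃ d : ℕ, D ≤ (d : ℝ) ∧ (d : ℝ) ≤ 2 * D ∧ d ^ 2 ∣ n}

/-! Everything follows from one estimate: for `1 ≤ D ≤ x^(1/3)` the count is `O(x^(1/2) D^(-1/16))`,
a power saving over the trivial bound by the number of palindromes.

A palindrome is cut into digit blocks `r₁, r, z, ρ r` and the reverse of `r₁`, where `r < L = E²`,
`z < Z`, and `ρ` reverses a block. Fix `r₁`. If `d²` divides `n`, with `d` coprime to `b` and `Z ≤
d²`, then `(d, r)` determines `z`, so it suffices to count pairs `(d, r)`. The gain over all `D₀ L`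
pairs is a factor about `E`.

For fixed `d`, subtracting two multiples of `d²` gives `d² p = (r - r') + L(z - z') + LZ(ρ r - ρ
r')`. Modulo `L`, `p` is linear in `r` with slope `a = d⁻²`; by size, `p` lies within `O(E)` of a
translate of `LZ ρ(r)/d²`. For `d` in an interval of length `D₀/L`, that function may be replaced by
one independent of `d` (`exists_window_of_sq_dvd`). So `a r - s(r)` falls in a window of length
`O(E)` modulo `L`. A variance bound over all slopes shows that on average only `O(E)` values of `r`
do so, up to a divisor factor (`ZMod.mul_sum_card_line_window_le`), and no slope comes from too many
`d` (`ZMod.card_sq_eq_Ico_le`).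

Taking `E ≈ D₀^(1/4)`, `Z ≈ D₀²/E` and summing over digit lengths gives the estimate; both parts are
then comparisons of exponents. -/

/-! ### Second moments of lines over `ZMod L` -/

open Finset in
theorem ZMod.card_filter_mul_eq_le (L : ℕ) [NeZero L] (x y : ZMod L) :
    #{a : ZMod L | a * x = y} ≤ Nat.gcd x.val L := by
  classical
  have hg : 0 < Nat.gcd x.val L := Nat.gcd_pos_of_pos_right _ (NeZero.pos L)
  rcases Finset.eq_empty_or_nonempty ({a : ZMod L | a * x = y} : Finset (ZMod L)) with h | ⟨a₀, h₀⟩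
  · simp [h]
  refine le_trans ?_ (IsAddCyclic.card_nsmul_eq_zero_le (α := ZMod L) hg)
  refine Finset.card_le_card_of_injOn (fun a => a - a₀) ?_ (fun a _ a' _ h => by simpa using h)
  intro a ha
  simp only [coe_filter, mem_univ, true_and, Set.mem_ofPred_eq, mem_filter] at ha h₀ ⊢
  have h1 : (a - a₀) * x = 0 := by rw [sub_mul, ha, h₀, sub_self]
  have h2 : ((Nat.gcd x.val L : ℕ) : ZMod L) = x * ((Nat.gcdA x.val L : ℤ) : ZMod L) := by
    have := congrArg (Int.cast : ℤ → ZMod L) (Nat.gcd_eq_gcd_ab x.val L)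
    push_cast at this
    simpa using this
  rw [nsmul_eq_mul, h2, mul_comm, ← mul_assoc, h1, zero_mul]

open Finset in
theorem Nat.card_le_of_modEq {S : Finset ℕ} {M g : ℕ} (hS : ∀ w ∈ S, w < M)
    (h : ∀ w ∈ S, ∀ w' ∈ S, w ≡ w' [MOD g]) : #S ≤ M / g + 1 := by
  rw [← Finset.card_range (M / g + 1)]
  refine Finset.card_le_card_of_injOn (fun w => w / g) ?_ ?_
  · intro w hw
    simp only [coe_range, Set.mem_Iio]
    exact Nat.lt_succ_of_le (Nat.div_le_div_right (hS w hw).le)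
  · intro w hw w' hw' e
    have h1 : w % g = w' % g := h w hw w' hw'
    have e' : w / g = w' / g := e
    rw [← Nat.div_add_mod w g, ← Nat.div_add_mod w' g, h1, e']

open Finset in
-- Solubility in `a` forces `w` into one residue class modulo `g = gcd(x, L)`, leaving at most `M /
-- g + 1` values of `w`, each with at most `g` solutions.
theorem ZMod.sum_card_mul_add_natCast_eq_le (L : ℕ) [NeZero L] (M : ℕ) (x c : ZMod L) :
    ∑ w ∈ range M, #{a : ZMod L | a * x + w = c} ≤ M + Nat.gcd x.val L := by
  classical
  set g := Nat.gcd x.val L with hgdef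
  have hg : 0 < g := Nat.gcd_pos_of_pos_right _ (NeZero.pos L)
  have hgL : g ∣ L := Nat.gcd_dvd_right _ _
  set S : Finset ℕ := (range M).filter fun w : ℕ => ∃ a : ZMod L, a * x + (w : ZMod L) = c with hS
  have hcast : ∀ w ∈ S, ((w : ℕ) : ZMod g) = ZMod.castHom hgL (ZMod g) c := by
    intro w hw
    obtain ⟨a, ha⟩ := (mem_filter.mp hw).2
    rw [← ha, map_add, map_mul, map_natCast]
    have : ZMod.castHom hgL (ZMod g) x = 0 := by
      conv_lhs => rw [← ZMod.natCast_zmod_val x, map_natCast]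
      exact (ZMod.natCast_eq_zero_iff _ _).2 (Nat.gcd_dvd_left _ _)
    rw [this, mul_zero, zero_add]
  have h1 : #S ≤ M / g + 1 := by
    refine Nat.card_le_of_modEq (fun w hw => by simpa using (mem_filter.mp hw).1) ?_
    intro w hw w' hw'
    exact (ZMod.natCast_eq_natCast_iff _ _ _).1 ((hcast w hw).trans (hcast w' hw').symm)
  have h2 : ∑ w ∈ range M, #{a : ZMod L | a * x + w = c} ≤ ∑ w ∈ range M, if w ∈ S then g else 0 := by
    refine sum_le_sum fun w hw => ?_
    split_ifs with hwS
    · have := ZMod.card_filter_mul_eq_le L x (c - w)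
      simpa only [eq_sub_iff_add_eq] using this
    · rw [Nat.le_zero, card_eq_zero, filter_eq_empty_iff]
      intro a _ ha
      exact hwS (mem_filter.mpr ⟨hw, a, ha⟩)
  refine h2.trans ?_
  rw [← sum_filter, sum_const, smul_eq_mul]
  have h3 : #{w ∈ range M | w ∈ S} ≤ M / g + 1 := by
    refine le_trans (card_le_card ?_) h1
    intro w hw
    exact (mem_filter.mp hw).2
  calc _ ≤ (M / g + 1) * g := Nat.mul_le_mul_right _ h3
    _ = M / g * g + g := by ring
    _ ≤ M + g := by gcongr; exact Nat.div_mul_le_self M g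

open Finset in
theorem ZMod.sum_gcd_val_le (L : ℕ) [NeZero L] :
    ∑ x : ZMod L, Nat.gcd x.val L ≤ L * #L.divisors := by
  classical
  have h1 : ∀ x : ZMod L, Nat.gcd x.val L ≤ ∑ g ∈ L.divisors, if g ∣ x.val then g else 0 := by
    intro x
    have := Finset.single_le_sum (s := L.divisors) (f := fun g => if g ∣ x.val then g else 0)
      (fun _ _ => Nat.zero_le _) (a := Nat.gcd x.val L)
      (Nat.mem_divisors.2 ⟨Nat.gcd_dvd_right _ _, NeZero.ne L⟩)
    simpa [Nat.gcd_dvd_left] using this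
  refine (sum_le_sum fun x _ => h1 x).trans ?_
  rw [sum_comm, mul_comm, ← smul_eq_mul, ← sum_const]
  refine sum_le_sum fun g hg => ?_
  obtain ⟨k, hk⟩ := (Nat.mem_divisors.1 hg).1
  have hL := NeZero.ne L
  have hg0 : 0 < g := Nat.pos_of_mem_divisors hg
  rw [← sum_filter, sum_const, smul_eq_mul]
  have : #{x : ZMod L | g ∣ x.val} ≤ k := by
    rw [← Finset.card_range k]
    refine Finset.card_le_card_of_injOn (fun x => x.val / g) ?_ ?_
    · intro x _
      simp only [coe_range, Set.mem_Iio]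
      rw [Nat.div_lt_iff_lt_mul hg0, mul_comm, ← hk]
      exact ZMod.val_lt x
    · intro x hx y hy e
      simp only [coe_filter, mem_univ, true_and, Set.mem_ofPred_eq] at hx hy
      refine ZMod.val_injective L ?_
      rw [← Nat.div_mul_cancel hx, ← Nat.div_mul_cancel hy]
      exact congrArg (· * g) e
  calc _ ≤ k * g := Nat.mul_le_mul_right _ this
    _ = L := by rw [hk, mul_comm]

open Finset in
theorem Finset.sum_card_fiber_sq {ι κ : Type*} [Fintype ι] [Fintype κ] [DecidableEq κ] (φ : ι → κ) :
    ∑ t, #{i | φ i = t} ^ 2 = ∑ i, #{i' | φ i = φ i'} := by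
  classical
  have : ∀ t, #{i | φ i = t} ^ 2 = ∑ i, if φ i = t then #{i' | φ i' = t} else 0 := by
    intro t
    rw [← sum_filter, sum_const, smul_eq_mul, sq]
  simp_rw [this]
  rw [sum_comm]
  refine sum_congr rfl fun i _ => ?_
  rw [sum_ite_eq]
  simp [eq_comm]

open Finset in
-- The second moment counts collisions between points `(r, w)` and `(r', w')`. Summed over slopes
-- and `w'`, these number at most `M + gcd(r - r', L)`, and the gcd is at most the divisor count on
-- average over `r'`. The shift `s` plays no role beyond a constant.
theorem ZMod.sum_card_line_fiber_sq_le (L M : ℕ) [NeZero L] (s : ZMod L → ZMod L) :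
    ∑ a : ZMod L, ∑ t : ZMod L,
      #{i : ZMod L × Fin M | ((i.2 : ℕ) : ZMod L) - a * i.1 + s i.1 = t} ^ 2 ≤
      L ^ 2 * M ^ 2 + L ^ 2 * M * #L.divisors := by
  classical
  simp_rw [Finset.sum_card_fiber_sq]
  rw [sum_comm]
  have key : ∀ i : ZMod L × Fin M,
      ∑ a : ZMod L, #{i' : ZMod L × Fin M | ((i.2 : ℕ) : ZMod L) - a * i.1 + s i.1 =
        ((i'.2 : ℕ) : ZMod L) - a * i'.1 + s i'.1} ≤ L * M + L * #L.divisors := by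
    intro i
    have e1 : ∀ a : ZMod L, #{i' : ZMod L × Fin M | ((i.2 : ℕ) : ZMod L) - a * i.1 + s i.1 =
        ((i'.2 : ℕ) : ZMod L) - a * i'.1 + s i'.1} =
        ∑ i' : ZMod L × Fin M, if a * (i.1 - i'.1) + ((i'.2 : ℕ) : ZMod L) =
          ((i.2 : ℕ) : ZMod L) + s i.1 - s i'.1 then 1 else 0 := by
      intro a
      rw [card_filter]
      refine sum_congr rfl fun i' _ => ?_
      congr 1
      refine propext ⟨fun h => by linear_combination -h, fun h => by linear_combination -h⟩
    simp_rw [e1]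
    rw [sum_comm, Fintype.sum_prod_type]
    have e2 : ∀ r' : ZMod L, ∑ w' : Fin M, ∑ a : ZMod L,
        (if a * (i.1 - r') + ((w' : ℕ) : ZMod L) =
          ((i.2 : ℕ) : ZMod L) + s i.1 - s r' then 1 else 0) ≤ M + Nat.gcd (i.1 - r').val L := by
      intro r'
      have := ZMod.sum_card_mul_add_natCast_eq_le L M (i.1 - r') (((i.2 : ℕ) : ZMod L) + s i.1 - s r')
      rw [← Fin.sum_univ_eq_sum_range (fun w => #{a : ZMod L | a * (i.1 - r') + (w : ZMod L) =
          ((i.2 : ℕ) : ZMod L) + s i.1 - s r'})] at this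
      simpa only [card_filter] using this
    refine (sum_le_sum fun r' _ => e2 r').trans ?_
    rw [sum_add_distrib, sum_const, card_univ, ZMod.card, smul_eq_mul]
    gcongr
    exact (Equiv.sum_comp (Equiv.subLeft i.1) (fun x : ZMod L => Nat.gcd x.val L)).trans_le
      (ZMod.sum_gcd_val_le L)
  refine (sum_le_sum fun i _ => key i).trans ?_
  rw [sum_const, card_univ, Fintype.card_prod, ZMod.card, Fintype.card_fin, smul_eq_mul]
  apply le_of_eq
  ring

open Finset in
/-- For most slopes `a` modulo `L`, no translate of the graph `r ↦ a * r - s r` meets a window of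
length `B` much more often than expected. -/
theorem ZMod.mul_sum_card_line_window_le (L B : ℕ) [NeZero L] (s t : ZMod L → ZMod L) :
    B * ∑ a : ZMod L, #{r : ZMod L | ∃ w < B, a * r - s r + t a = ((w : ℕ) : ZMod L)} ≤
      3 * B ^ 2 * L + 2 * L ^ 2 * #L.divisors := by
  classical
  set f : ZMod L → ℕ := fun a =>
    #{r : ZMod L | ∃ w < B, a * r - s r + t a = ((w : ℕ) : ZMod L)} with hf
  set G : ZMod L → ZMod L → ℕ := fun a u =>
    #{i : ZMod L × Fin (2 * B) | ((i.2 : ℕ) : ZMod L) - a * i.1 + s i.1 = u} with hG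
  rcases Nat.eq_zero_or_pos B with hB | hB
  · simp [hB]
  have hsum : ∀ a, ∑ u, (G a u : ℤ) = 2 * B * L := by
    intro a
    have := Finset.card_eq_sum_card_fiberwise (s := (univ : Finset (ZMod L × Fin (2 * B))))
      (t := (univ : Finset (ZMod L)))
      (f := fun i => ((i.2 : ℕ) : ZMod L) - a * i.1 + s i.1) (fun _ _ => by simp)
    rw [card_univ, Fintype.card_prod, ZMod.card, Fintype.card_fin] at this
    have h2 := congrArg (Nat.cast : ℕ → ℤ) this
    push_cast at h2
    rw [hG]
    linarith
  have hvar : ∑ a : ZMod L, ∑ u : ZMod L, ((G a u : ℤ) - 2 * B) ^ 2 ≤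
      (2 * B * L ^ 2 * #L.divisors : ℤ) := by
    have h1 := ZMod.sum_card_line_fiber_sq_le L (2 * B) s
    have h2 : ∑ a : ZMod L, ∑ u : ZMod L, (G a u : ℤ) ^ 2 ≤
        L ^ 2 * (2 * B) ^ 2 + L ^ 2 * (2 * B) * #L.divisors := by exact_mod_cast h1
    have h3 : ∀ a, ∑ u : ZMod L, ((G a u : ℤ) - 2 * B) ^ 2 =
        ∑ u, (G a u : ℤ) ^ 2 - 4 * B ^ 2 * L := by
      intro a
      have : ∀ u, ((G a u : ℤ) - 2 * B) ^ 2 = (G a u : ℤ) ^ 2 - 4 * B * G a u + 4 * B ^ 2 := by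
        intro u; ring
      simp_rw [this]
      rw [sum_add_distrib, sum_sub_distrib, ← mul_sum, hsum, sum_const, card_univ, ZMod.card]
      simp only [nsmul_eq_mul]
      ring
    simp_rw [h3]
    rw [sum_sub_distrib, sum_const, card_univ, ZMod.card, nsmul_eq_mul]
    nlinarith [h2]
  -- A Chebyshev bound: either the window count is at most `3B`, or it is charged to the variance of
  -- `G a` about its mean `2B`.
  have hpt : ∀ a, (B : ℤ) * (B * f a) ≤ 3 * B ^ 3 + ∑ u : ZMod L, ((G a u : ℤ) - 2 * B) ^ 2 := by
    intro a
    have hnn : 0 ≤ ∑ u : ZMod L, ((G a u : ℤ) - 2 * B) ^ 2 := sum_nonneg fun _ _ => sq_nonneg _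
    by_cases hfa : f a ≤ 3 * B
    · have : (f a : ℤ) ≤ 3 * B := by exact_mod_cast hfa
      have hB2 : (0 : ℤ) ≤ B ^ 2 := sq_nonneg _
      nlinarith
    push Not at hfa
    have hfL : f a ≤ L := by
      have := card_le_univ ({r : ZMod L | ∃ w < B, a * r - s r + t a = ((w : ℕ) : ZMod L)} :
        Finset (ZMod L))
      rwa [ZMod.card] at this
    have hBL : B ≤ L := by omega
    -- The reason `G` uses windows of length `2B`: a window of length `B` lies in `B` translates of
    -- the doubled one, so one large count forces `B` large values of `G a`. These sit at distinct
    -- residues because `B ≤ L`.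
    have hge : ∀ i < B, f a ≤ G a (t a + ((i : ℕ) : ZMod L)) := by
      intro i hi
      have hex : ∀ r : ZMod L, (∃ w < B, a * r - s r + t a = ((w : ℕ) : ZMod L)) →
          ∃ w : Fin B, a * r - s r + t a = (((w : ℕ)) : ZMod L) := by
        rintro r ⟨w, hw, h⟩; exact ⟨⟨w, hw⟩, h⟩
      have hBpos : Nonempty (Fin B) := ⟨⟨0, hB⟩⟩
      choose! w hw using hex
      refine Finset.card_le_card_of_injOn (fun r => (r, ⟨(w r : ℕ) + i, by have := (w r).2; omega⟩))
        ?_ ?_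
      · intro r hr
        simp only [coe_filter, mem_univ, true_and, Set.mem_ofPred_eq] at hr ⊢
        have := hw r hr
        push_cast
        linear_combination -this
      · intro r _ r' _ h
        exact (Prod.mk.inj h).1
    have hinj : Set.InjOn (fun i : ℕ => t a + ((i : ℕ) : ZMod L)) (range B) := by
      intro i hi j hj h
      simp only [coe_range, Set.mem_Iio] at hi hj
      have h' : ((i : ℕ) : ZMod L) = j := by simpa using h
      rw [ZMod.natCast_eq_natCast_iff] at h'
      exact Nat.ModEq.eq_of_lt_of_lt h' (by omega) (by omega)
    have hlow : (B : ℤ) * ((f a : ℤ) - 2 * B) ^ 2 ≤ ∑ u : ZMod L, ((G a u : ℤ) - 2 * B) ^ 2 := by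
      calc (B : ℤ) * ((f a : ℤ) - 2 * B) ^ 2 = ∑ i ∈ range B, ((f a : ℤ) - 2 * B) ^ 2 := by
            rw [sum_const, card_range, nsmul_eq_mul]
        _ ≤ ∑ i ∈ range B, ((G a (t a + ((i : ℕ) : ZMod L)) : ℤ) - 2 * B) ^ 2 := by
            refine sum_le_sum fun i hi => ?_
            have h1 : (f a : ℤ) ≤ G a (t a + ((i : ℕ) : ZMod L)) := by
              exact_mod_cast hge i (by simpa using hi)
            have h2 : (0 : ℤ) ≤ (f a : ℤ) - 2 * B := by
              have : (3 * B : ℤ) < f a := by exact_mod_cast hfa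
              linarith
            gcongr
        _ = ∑ u ∈ (range B).image (fun i : ℕ => t a + ((i : ℕ) : ZMod L)),
              ((G a u : ℤ) - 2 * B) ^ 2 := by
            rw [sum_image hinj]
        _ ≤ _ := sum_le_sum_of_subset_of_nonneg (subset_univ _) fun _ _ _ => sq_nonneg _
    have hB0 : (0 : ℤ) < B := by exact_mod_cast hB
    have : (B : ℤ) * f a ≤ 3 * B ^ 2 + ((f a : ℤ) - 2 * B) ^ 2 := by
      nlinarith [sq_nonneg ((f a : ℤ) - 2 * B - B), sq_nonneg ((f a : ℤ) - 2 * B)]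
    nlinarith
  have htot : (B : ℤ) * (B * ∑ a, (f a : ℤ)) ≤ B * (3 * B ^ 2 * L + 2 * L ^ 2 * #L.divisors) := by
    have := sum_le_sum fun a (_ : a ∈ (univ : Finset (ZMod L))) => hpt a
    rw [← mul_sum, ← mul_sum, sum_add_distrib, sum_const, card_univ, ZMod.card,
      nsmul_eq_mul] at this
    linarith
  have hB0 : (0 : ℤ) < B := by exact_mod_cast hB
  have := le_of_mul_le_mul_left htot hB0
  exact_mod_cast this

/-! ### Square roots modulo `L` in short intervals -/

/-- Write `L = e k` with `e` the common gcd. Then `e` divides `a - c` and `b - c`, while `k` divides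
`a + c` and `b + c`, so both divide `a - b`. A common divisor of `e` and `k` divides `2a`, hence
divides `2` since `a` is a unit modulo `L`; this is the only loss. -/
theorem Int.dvd_two_mul_sub_of_sq_modEq {L a b c : ℤ} (hL : L ≠ 0) (ha : IsCoprime a L)
    (hab : L ∣ (a - c) * (a + c)) (hbc : L ∣ (b - c) * (b + c))
    (hg : Int.gcd (a - c) L = Int.gcd (b - c) L) : L ∣ 2 * (a - b) := by
  have key : ∀ v : ℤ, L ∣ (v - c) * (v + c) → ∀ e k : ℤ, e = Int.gcd (v - c) L → L = e * k →
      e ∣ v - c ∧ k ∣ v + c := by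
    intro v hv e k he hk
    have h1 : e ∣ v - c := he ▸ Int.gcd_dvd_left _ _
    refine ⟨h1, ?_⟩
    obtain ⟨u, hu⟩ := h1
    have he0 : e ≠ 0 := by rintro rfl; simp at hk; exact hL hk
    have hcop : IsCoprime k u := by
      rw [Int.isCoprime_iff_gcd_eq_one, Int.gcd_comm]
      have h2 : Int.gcd (e * u) (e * k) = e.natAbs * Int.gcd u k := Int.gcd_mul_left _ _ _
      rw [← hu, ← hk] at h2
      have h3 : e.natAbs = Int.gcd (v - c) L := by rw [he]; simp
      rw [← h3] at h2
      have h4 : 0 < e.natAbs := Int.natAbs_pos.2 he0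
      exact (Nat.eq_of_mul_eq_mul_left h4 (by rw [mul_one]; exact h2)).symm
    rw [hu, hk, mul_assoc] at hv
    exact hcop.dvd_of_dvd_mul_left (Int.dvd_of_mul_dvd_mul_left he0 hv)
  obtain ⟨k, hk⟩ := Int.gcd_dvd_right (a := a - c) (b := L)
  obtain ⟨h1, h2⟩ := key a hab _ k rfl hk
  obtain ⟨h3, h4⟩ := key b hbc _ k (by rw [hg]) hk
  set e : ℤ := (Int.gcd (a - c) L : ℤ)
  have h5 : e ∣ a - b := by simpa using dvd_sub h1 h3
  have h6 : k ∣ a - b := by simpa using dvd_sub h2 h4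
  obtain ⟨x, y, hxy⟩ : ∃ x y : ℤ, 2 = e * x + k * y := by
    obtain ⟨p, q, hpq⟩ := ha
    obtain ⟨m, hm⟩ := h1
    obtain ⟨n, hn⟩ := h2
    refine ⟨p * m + 2 * q * k, p * n, ?_⟩
    linear_combination (-2) * hpq + p * hm + p * hn + 2 * q * hk
  rw [hk, hxy, add_mul]
  refine dvd_add ?_ ?_
  · rw [mul_assoc]
    exact mul_dvd_mul_left e (h6.mul_left x)
  · rw [mul_comm e k, mul_assoc]
    exact mul_dvd_mul_left k (h5.mul_left y)

open Finset in
-- Fix one root `d₀` and sort the others by `gcd(d - d₀, L)`, a divisor of `L`. Within a class all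
-- `2d` agree modulo `L`.
theorem ZMod.card_sq_eq_Ico_le (L x δ : ℕ) [NeZero L] (c : ZMod L) :
    #{d ∈ Ico x (x + δ) | Nat.Coprime d L ∧ (d : ZMod L) ^ 2 = c} ≤
      (2 * δ / L + 1) * #L.divisors := by
  classical
  set S := {d ∈ Ico x (x + δ) | Nat.Coprime d L ∧ (d : ZMod L) ^ 2 = c} with hS
  rcases S.eq_empty_or_nonempty with h | ⟨d₀, h₀⟩
  · simp [h]
  have hL : (L : ℤ) ≠ 0 := by exact_mod_cast NeZero.ne L
  refine Finset.card_le_mul_card_image_of_maps_to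
    (f := fun d : ℕ => Int.gcd ((d : ℤ) - d₀) L) ?_ _ ?_
  · intro d _
    refine Nat.mem_divisors.2 ⟨?_, NeZero.ne L⟩
    exact_mod_cast Int.gcd_dvd_right (a := (d : ℤ) - d₀) (b := L)
  intro e _
  have hinj : Set.InjOn (fun d => 2 * (d - x))
      (({d ∈ S | Int.gcd ((d : ℤ) - d₀) L = e} : Finset ℕ) : Set ℕ) := by
    intro d hd d' hd' h
    simp only [coe_filter, Set.mem_ofPred_eq, hS, mem_filter, mem_Ico] at hd hd' h
    omega
  rw [← Finset.card_image_of_injOn hinj]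
  refine Nat.card_le_of_modEq ?_ ?_
  · intro w hw
    obtain ⟨d, hd, rfl⟩ := mem_image.1 hw
    simp only [hS, mem_filter, mem_Ico] at hd
    omega
  · intro w hw w' hw'
    obtain ⟨d, hd, rfl⟩ := mem_image.1 hw
    obtain ⟨d', hd', rfl⟩ := mem_image.1 hw'
    simp only [hS, mem_filter, mem_Ico] at hd hd' h₀
    have hsq : ∀ v : ℕ, (v : ZMod L) ^ 2 = c → (L : ℤ) ∣ ((v : ℤ) - d₀) * (v + d₀) := by
      intro v hv
      rw [← ZMod.intCast_zmod_eq_zero_iff_dvd]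
      push_cast
      linear_combination hv - h₀.2.2
    have := Int.dvd_two_mul_sub_of_sq_modEq hL (Nat.isCoprime_iff_coprime.2 hd'.1.2.1)
      (hsq d' hd'.1.2.2) (hsq d hd.1.2.2) (by rw [hd.2, hd'.2])
    rw [Nat.modEq_iff_dvd]
    have e1 : ((2 * (d' - x) : ℕ) : ℤ) - (2 * (d - x) : ℕ) = 2 * ((d' : ℤ) - d) := by
      rw [Nat.cast_mul, Nat.cast_mul, Nat.cast_sub hd'.1.1.1, Nat.cast_sub hd.1.1.1]
      push_cast; ring
    rwa [e1]

/-! ### Pairs `(d, r)` for a fixed outer block -/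

/-- For fixed `d` in a short interval starting at `d₀`, divisibility by `d ^ 2` confines the low
digit block `r` to a line modulo `L` meeting a window of length `5 * E`. -/
theorem exists_window_of_sq_dvd {E K L Z D₀ d₀ δ n₀ d : ℕ} [NeZero L] {ρ : ℕ → ℕ}
    (hE : 1 ≤ E) (hL : L = E ^ 2) (hK : 1 ≤ K) (hD : 1 ≤ D₀) (hZ : E * Z ≤ D₀ ^ 2)
    (hδ : L * δ ≤ D₀) (hρ : ∀ r, ρ r < L) (hd₀ : D₀ ≤ d₀) (hd : d₀ ≤ d) (hdδ : d < d₀ + δ)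
    (hdK : Nat.Coprime d K) (hdL : Nat.Coprime d L) :
    ∃ t : ZMod L, ∀ r < L, ∀ z < Z, d ^ 2 ∣ n₀ + K * (r + L * (z + Z * ρ r)) →
      ∃ w < 5 * E, ((d : ZMod L) ^ 2)⁻¹ * (r : ZMod L) - ((L * Z * ρ r / d₀ ^ 2 : ℕ) : ZMod L) + t =
        ((w : ℕ) : ZMod L) := by
  by_cases hex : ∃ r < L, ∃ z < Z, d ^ 2 ∣ n₀ + K * (r + L * (z + Z * ρ r))
  swap
  · push Not at hex
    exact ⟨0, fun r hr z hz h => absurd h (hex r hr z hz)⟩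
  obtain ⟨r', hr', z', hz', q', hq'⟩ := hex
  set a : ZMod L := ((d : ZMod L) ^ 2)⁻¹ with ha
  have had : a * (d : ZMod L) ^ 2 = 1 := by
    rw [ha, mul_comm]
    have := ZMod.coe_mul_inv_eq_one (n := L) (d ^ 2) (Nat.Coprime.pow_left 2 hdL)
    exact_mod_cast this
  set A : ℕ := r' + L * (z' + Z * ρ r') with hA
  -- The solution `r'` serves as base point. The quantity `p + u - s` will lie in `[-2E, E]`; the
  -- shift `2E` makes it a natural number below `5E`.
  refine ⟨-(a * r') + (A / d ^ 2 : ℕ) + (2 * E : ℕ), ?_⟩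
  rintro r hr z hz ⟨q, hq⟩
  obtain ⟨p, hp⟩ : (K : ℤ) ∣ (q : ℤ) - q' := by
    have h1 : (K : ℤ) ∣ (d : ℤ) ^ 2 * ((q : ℤ) - q') := by
      refine ⟨((r + L * (z + Z * ρ r) : ℕ) : ℤ) - A, ?_⟩
      have e1 : (n₀ : ℤ) + K * (r + L * (z + Z * ρ r)) = (d : ℤ) ^ 2 * q := by
        exact_mod_cast hq
      have e2 : (n₀ : ℤ) + K * (A : ℤ) = (d : ℤ) ^ 2 * q' := by exact_mod_cast hq'
      push_cast
      linear_combination e2 - e1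
    have h2 : IsCoprime (K : ℤ) ((d : ℤ) ^ 2) := (Nat.isCoprime_iff_coprime.2 hdK.symm).pow_right
    exact h2.dvd_of_dvd_mul_left h1
  have hK0 : (K : ℤ) ≠ 0 := by exact_mod_cast (by omega : K ≠ 0)
  have hpd : (p : ℤ) * d ^ 2 = (r : ℤ) + L * z + L * Z * ρ r - A := by
    have e1 : (n₀ : ℤ) + K * (r + L * (z + Z * ρ r)) = (d : ℤ) ^ 2 * q := by exact_mod_cast hq
    have e2 : (n₀ : ℤ) + K * (A : ℤ) = (d : ℤ) ^ 2 * q' := by exact_mod_cast hq'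
    refine mul_left_cancel₀ hK0 ?_
    linear_combination e2 - e1 - (d : ℤ) ^ 2 * hp
  set s : ℕ := L * Z * ρ r / d₀ ^ 2 with hs
  set u : ℕ := A / d ^ 2 with hu
  have hd1 : 1 ≤ d := by omega
  have hd0' : 1 ≤ d₀ := by omega
  have hdd : (0 : ℤ) < (d : ℤ) ^ 2 := by positivity
  have hdd0 : (0 : ℤ) < (d₀ : ℤ) ^ 2 := by positivity
  have hu1 : (u : ℤ) * d ^ 2 ≤ A := by exact_mod_cast Nat.div_mul_le_self A (d ^ 2)
  have hu2 : (A : ℤ) < (u + 1) * d ^ 2 := by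
    have := Nat.lt_mul_div_succ A (b := d ^ 2) (by positivity)
    rw [mul_comm] at this
    exact_mod_cast this
  have hs1 : (s : ℤ) * d₀ ^ 2 ≤ L * Z * ρ r := by
    exact_mod_cast Nat.div_mul_le_self (L * Z * ρ r) (d₀ ^ 2)
  have hs2 : (L : ℤ) * Z * ρ r < (s + 1) * d₀ ^ 2 := by
    have := Nat.lt_mul_div_succ (L * Z * ρ r) (b := d₀ ^ 2) (by positivity)
    rw [mul_comm (d₀ ^ 2), ← hs] at this
    exact_mod_cast this
  have hLZ : (L : ℤ) * Z ≤ E * D₀ ^ 2 := by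
    have : L * Z ≤ E * D₀ ^ 2 := by
      calc L * Z = E * (E * Z) := by rw [hL]; ring
        _ ≤ _ := Nat.mul_le_mul_left _ hZ
    exact_mod_cast this
  have hy : (r : ℤ) + L * z + 1 ≤ L * Z := by
    have : r + L * z + 1 ≤ L * Z := by
      calc r + L * z + 1 ≤ L * (z + 1) := by rw [mul_add]; omega
        _ ≤ _ := Nat.mul_le_mul_left _ hz
    exact_mod_cast this
  have hDd0 : (D₀ : ℤ) ≤ d₀ := by exact_mod_cast hd₀
  have hd0d : (d₀ : ℤ) ≤ d := by exact_mod_cast hd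
  have hD0 : (0 : ℤ) ≤ D₀ := by positivity
  have hE0 : (0 : ℤ) ≤ E := by positivity
  have hsq1 : (D₀ : ℤ) ^ 2 ≤ d₀ ^ 2 := by gcongr
  have hsq2 : (d₀ : ℤ) ^ 2 ≤ d ^ 2 := by gcongr
  have hup : p + u < s + 1 + E := by
    refine lt_of_mul_lt_mul_right ?_ hdd.le
    have h1 : ((s : ℤ) + 1) * d₀ ^ 2 ≤ (s + 1) * d ^ 2 := by gcongr
    have h2 : (E : ℤ) * D₀ ^ 2 ≤ E * d ^ 2 := by gcongr; exact hd₀.trans hd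
    linarith
  -- The cost of using `d₀²` in place of `d²` in the definition of `s`: it stays within `2E`
  -- multiples of `d²` because `δ ≤ D₀ / L`.
  have hdrift : (s : ℤ) * (d ^ 2 - d₀ ^ 2) ≤ 2 * E * d ^ 2 := by
    refine le_of_mul_le_mul_left ?_ hdd0
    have h1 : (d : ℤ) ^ 2 - d₀ ^ 2 ≤ 2 * d * δ := by
      have : (d : ℤ) < d₀ + δ := by exact_mod_cast hdδ
      calc (d : ℤ) ^ 2 - d₀ ^ 2 = (d + d₀) * (d - d₀) := by ring
        _ ≤ (2 * d) * δ := by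
          apply mul_le_mul <;> linarith
    have h2 : (L : ℤ) * Z * ρ r ≤ L * Z * L := by
      have : (ρ r : ℤ) ≤ L := by exact_mod_cast (hρ r).le
      gcongr
    have h3 : (L : ℤ) * δ ≤ D₀ := by exact_mod_cast hδ
    calc (d₀ : ℤ) ^ 2 * (s * (d ^ 2 - d₀ ^ 2)) = (s : ℤ) * d₀ ^ 2 * ((d : ℤ) ^ 2 - d₀ ^ 2) := by ring
      _ ≤ (L : ℤ) * Z * L * (2 * d * δ) := by
        apply mul_le_mul (hs1.trans h2) h1 (by linarith) (by positivity)
      _ = (L : ℤ) * Z * (2 * d) * (L * δ) := by ring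
      _ ≤ (E : ℤ) * D₀ ^ 2 * (2 * d) * D₀ := by gcongr
      _ ≤ (E : ℤ) * d₀ ^ 2 * (2 * d) * d := by gcongr; exact hd₀.trans hd
      _ = (d₀ : ℤ) ^ 2 * (2 * E * d ^ 2) := by ring
  have hlow : (s : ℤ) - 2 * E - 1 < p + u := by
    refine lt_of_mul_lt_mul_right ?_ hdd.le
    have : (0 : ℤ) ≤ r + L * z := by positivity
    linarith
  refine ⟨(p + u - s + 2 * E).toNat, ?_, ?_⟩
  · have : (1 : ℤ) ≤ E := by exact_mod_cast hE
    omega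
  · have h0 : 0 ≤ p + u - s + 2 * E := by omega
    have hcast : (((p + u - s + 2 * E).toNat : ℕ) : ZMod L) =
        ((p + u - s + 2 * E : ℤ) : ZMod L) := by
      rw [← Int.cast_natCast, Int.toNat_of_nonneg h0]
    rw [hcast]
    have hp' : (p : ZMod L) * (d : ZMod L) ^ 2 = r - r' := by
      have := congrArg (Int.cast : ℤ → ZMod L) hpd
      rw [hA] at this
      push_cast at this
      rw [this]
      simp
    have hp'' : (p : ZMod L) = a * r - a * r' := by
      linear_combination a * hp' - p * had
    push_cast
    rw [hp'']
    ring

open Finset in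
-- Each `d` contributes at most the window count of its slope `d⁻²`; grouping by slope costs the
-- multiplicity `(2δ/L + 1)τ`, which is at most `3δτ/L` since `L ≤ δ`. The slopes together
-- contribute at most `16 E³ τ`.
theorem card_block_sq_dvd_le {E K L Z D₀ d₀ δ n₀ : ℕ} {ρ : ℕ → ℕ}
    (hE : 1 ≤ E) (hL : L = E ^ 2) (hK : 1 ≤ K) (hD : 1 ≤ D₀) (hZ : E * Z ≤ D₀ ^ 2)
    (hδ : L * δ ≤ D₀) (hLδ : L ≤ δ) (hρ : ∀ r, ρ r < L) (hd₀ : D₀ ≤ d₀) :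
    #{i ∈ Ico d₀ (d₀ + δ) ×ˢ range L | Nat.Coprime i.1 K ∧ Nat.Coprime i.1 L ∧
      ∃ z < Z, i.1 ^ 2 ∣ n₀ + K * (i.2 + L * (z + Z * ρ i.2))} ≤
    48 * #L.divisors ^ 2 * E * δ := by
  classical
  have hL1 : 1 ≤ L := by rw [hL]; exact Nat.one_le_pow _ _ hE
  have : NeZero L := ⟨by omega⟩
  set τ := #L.divisors with hτ
  have hτ1 : 1 ≤ τ := Finset.card_pos.2 ⟨1, Nat.one_mem_divisors.2 (by omega)⟩
  set s : ZMod L → ZMod L := fun r => ((L * Z * ρ r.val / d₀ ^ 2 : ℕ) : ZMod L) with hs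
  set cnt : ZMod L → ZMod L → ℕ := fun a t =>
    #{r : ZMod L | ∃ w < 5 * E, a * r - s r + t = ((w : ℕ) : ZMod L)} with hcnt
  -- The translate depends on `d`, not only on its slope, so the worst translate is taken for each
  -- slope.
  have hmax : ∀ a, ∃ t, ∀ u, cnt a u ≤ cnt a t := fun a => Finite.exists_max (cnt a)
  choose t ht using hmax
  have hsum : ∑ a, cnt a (t a) ≤ 16 * E ^ 3 * τ := by
    have h1 := ZMod.mul_sum_card_line_window_le L (5 * E) s t
    have h2 : 5 * E * ∑ a, cnt a (t a) ≤ 5 * E * (16 * E ^ 3 * τ) := by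
      refine h1.trans ?_
      rw [hL]
      have h3 : E ^ 4 ≤ E ^ 4 * τ := Nat.le_mul_of_pos_right _ hτ1
      rw [hτ, hL] at h3
      rw [hτ, hL]
      have h4 : 0 ≤ E ^ 4 * #(E ^ 2).divisors := Nat.zero_le _
      linarith
    exact Nat.le_of_mul_le_mul_left h2 (by omega)
  set P := Ico d₀ (d₀ + δ) with hP
  set Q := {d ∈ P | Nat.Coprime d K ∧ Nat.Coprime d L} with hQ
  set good : ℕ → Finset ℕ := fun d =>
    {r ∈ range L | ∃ z < Z, d ^ 2 ∣ n₀ + K * (r + L * (z + Z * ρ r))} with hgood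
  have hstep : ∀ d ∈ Q, #(good d) ≤ cnt (((d : ZMod L) ^ 2)⁻¹) (t (((d : ZMod L) ^ 2)⁻¹)) := by
    intro d hd
    simp only [hQ, hP, mem_filter, mem_Ico] at hd
    obtain ⟨u, hu⟩ := exists_window_of_sq_dvd (n₀ := n₀) hE hL hK hD hZ hδ hρ hd₀ hd.1.1 hd.1.2 hd.2.1 hd.2.2
    refine le_trans ?_ (ht _ u)
    refine Finset.card_le_card_of_injOn (fun r => (r : ZMod L)) ?_ ?_
    · intro r hr
      simp only [hgood, coe_filter, mem_range, Set.mem_ofPred_eq] at hr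
      obtain ⟨hr, z, hz, hdiv⟩ := hr
      simp only [coe_filter, mem_univ, true_and, Set.mem_ofPred_eq, hs]
      rw [ZMod.val_natCast_of_lt hr]
      exact hu r hr z hz hdiv
    · intro r hr r' hr' h
      simp only [hgood, coe_filter, mem_range, Set.mem_ofPred_eq] at hr hr'
      have h' := (ZMod.natCast_eq_natCast_iff _ _ _).1 h
      exact Nat.ModEq.eq_of_lt_of_lt h' hr.1 hr'.1
  have hmult : ∀ a : ZMod L, #(Q.filter fun d : ℕ => ((d : ZMod L) ^ 2)⁻¹ = a) ≤ (2 * δ / L + 1) * τ := by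
    intro a
    rcases Finset.eq_empty_or_nonempty (Q.filter fun d : ℕ => ((d : ZMod L) ^ 2)⁻¹ = a) with h | ⟨d', hd'⟩
    · simp [h]
    refine le_trans (card_le_card ?_) (ZMod.card_sq_eq_Ico_le L d₀ δ ((d' : ZMod L) ^ 2))
    have hinv : ∀ v : ℕ, Nat.Coprime v L → (v : ZMod L) ^ 2 * ((v : ZMod L) ^ 2)⁻¹ = 1 := by
      intro v hv
      have := ZMod.coe_mul_inv_eq_one (n := L) (v ^ 2) (Nat.Coprime.pow_left 2 hv)
      exact_mod_cast this
    intro d hd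
    simp only [hQ, mem_filter] at hd hd' ⊢
    refine ⟨hd.1.1, hd.1.2.2, ?_⟩
    have h1 := hinv d hd.1.2.2
    have h2 := hinv d' hd'.1.2.2
    rw [hd.2] at h1
    rw [hd'.2] at h2
    linear_combination (d' : ZMod L) ^ 2 * h1 - (d : ZMod L) ^ 2 * h2
  have hcard : #{i ∈ P ×ˢ range L | Nat.Coprime i.1 K ∧ Nat.Coprime i.1 L ∧
      ∃ z < Z, i.1 ^ 2 ∣ n₀ + K * (i.2 + L * (z + Z * ρ i.2))} ≤ ∑ d ∈ Q, #(good d) := by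
    rw [← Finset.card_sigma]
    refine Finset.card_le_card_of_injOn (fun i => ⟨i.1, i.2⟩) ?_ ?_
    · intro i hi
      simp only [coe_filter, mem_product, Set.mem_ofPred_eq, mem_range] at hi
      simp only [coe_sigma, Set.mem_sigma_iff, mem_coe, hQ, hgood, mem_filter, mem_range]
      tauto
    · rintro ⟨a, b⟩ _ ⟨a', b'⟩ _ h
      simp only [Sigma.mk.injEq, heq_eq_eq] at h
      rw [h.1, h.2]
  calc _ ≤ ∑ d ∈ Q, #(good d) := hcard
    _ ≤ ∑ d ∈ Q, cnt (((d : ZMod L) ^ 2)⁻¹) (t (((d : ZMod L) ^ 2)⁻¹)) := sum_le_sum hstep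
    _ = ∑ a : ZMod L, ∑ d ∈ Q.filter (fun d : ℕ => ((d : ZMod L) ^ 2)⁻¹ = a),
          cnt (((d : ZMod L) ^ 2)⁻¹) (t (((d : ZMod L) ^ 2)⁻¹)) :=
        (sum_fiberwise Q (fun d : ℕ => ((d : ZMod L) ^ 2)⁻¹) _).symm
    _ = ∑ a : ZMod L, #(Q.filter fun d : ℕ => ((d : ZMod L) ^ 2)⁻¹ = a) * cnt a (t a) := by
        refine sum_congr rfl fun a _ => ?_
        rw [← smul_eq_mul, ← sum_const]
        refine sum_congr rfl fun d hd => ?_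
        rw [(mem_filter.1 hd).2]
    _ ≤ ∑ a : ZMod L, (2 * δ / L + 1) * τ * cnt a (t a) :=
        sum_le_sum fun a _ => Nat.mul_le_mul_right _ (hmult a)
    _ ≤ (2 * δ / L + 1) * τ * (16 * E ^ 3 * τ) := by
        rw [← mul_sum]; exact Nat.mul_le_mul_left _ hsum
    _ = ((2 * δ / L + 1) * L) * (16 * τ ^ 2 * E) := by rw [hL]; ring
    _ ≤ (3 * δ) * (16 * τ ^ 2 * E) := by
        refine Nat.mul_le_mul_right _ ?_
        have := Nat.div_mul_le_self (2 * δ) L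
        rw [add_mul, one_mul]
        omega
    _ = _ := by ring

open Finset in
/-- Few pairs `(d, r)` with `d ∈ [D₀, 2 * D₀]` admit a middle block `z` making the number with
digit blocks `r, z, ρ r` divisible by `d ^ 2`. -/
theorem card_sq_dvd_le {E K L Z D₀ n₀ : ℕ} {ρ : ℕ → ℕ}
    (hE : 1 ≤ E) (hL : L = E ^ 2) (hK : 1 ≤ K) (hED : E ^ 4 ≤ D₀) (hZ : E * Z ≤ D₀ ^ 2)
    (hρ : ∀ r, ρ r < L) :
    #{i ∈ Icc D₀ (2 * D₀) ×ˢ range L | Nat.Coprime i.1 K ∧ Nat.Coprime i.1 L ∧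
      ∃ z < Z, i.1 ^ 2 ∣ n₀ + K * (i.2 + L * (z + Z * ρ i.2))} ≤
    96 * #L.divisors ^ 2 * E * D₀ := by
  classical
  have hL1 : 1 ≤ L := by rw [hL]; exact Nat.one_le_pow _ _ hE
  have hD : 1 ≤ D₀ := le_trans (Nat.one_le_pow _ _ hE) hED
  set δ := D₀ / L with hδdef
  have hδ : L * δ ≤ D₀ := Nat.mul_div_le D₀ L
  have hLδ : L ≤ δ := by
    rw [hδdef, Nat.le_div_iff_mul_le hL1, hL]
    calc E ^ 2 * E ^ 2 = E ^ 4 := by ring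
      _ ≤ _ := hED
  have hD2 : D₀ < 2 * L * δ := by
    have := Nat.lt_mul_div_succ D₀ (b := L) hL1
    rw [← hδdef] at this
    nlinarith
  set B : ℕ → Finset (ℕ × ℕ) := fun j =>
    {i ∈ Ico (D₀ + j * δ) (D₀ + j * δ + δ) ×ˢ range L | Nat.Coprime i.1 K ∧ Nat.Coprime i.1 L ∧
      ∃ z < Z, i.1 ^ 2 ∣ n₀ + K * (i.2 + L * (z + Z * ρ i.2))} with hB
  have hsub : {i ∈ Icc D₀ (2 * D₀) ×ˢ range L | Nat.Coprime i.1 K ∧ Nat.Coprime i.1 L ∧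
      ∃ z < Z, i.1 ^ 2 ∣ n₀ + K * (i.2 + L * (z + Z * ρ i.2))} ⊆ (range (2 * L)).biUnion B := by
    rintro ⟨d, r⟩ hi
    simp only [mem_filter, mem_product, mem_Icc, mem_range] at hi
    simp only [mem_biUnion, mem_range, hB, mem_filter, mem_product, mem_Ico]
    have hδ0 : 0 < δ := by omega
    refine ⟨(d - D₀) / δ, ?_, ⟨⟨?_, ?_⟩, hi.1.2⟩, hi.2⟩
    · rw [Nat.div_lt_iff_lt_mul hδ0]; omega
    · have := Nat.div_mul_le_self (d - D₀) δ
      omega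
    · have := Nat.lt_div_mul_add (a := d - D₀) hδ0
      omega
  calc _ ≤ #((range (2 * L)).biUnion B) := card_le_card hsub
    _ ≤ ∑ j ∈ range (2 * L), #(B j) := card_biUnion_le
    _ ≤ ∑ j ∈ range (2 * L), 48 * #L.divisors ^ 2 * E * δ :=
        sum_le_sum fun j _ => card_block_sq_dvd_le hE hL hK hD hZ hδ hLδ hρ (by omega)
    _ = 96 * #L.divisors ^ 2 * E * (L * δ) := by
        rw [sum_const, card_range, smul_eq_mul]; ring
    _ ≤ _ := Nat.mul_le_mul_left _ hδ

/-! ### Palindromes as digit blocks -/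

theorem List.exists_eq_append_of_reverse_eq {α : Type*} {ds : List α} (h : ds.reverse = ds) {j : ℕ}
    (hj : 2 * j ≤ ds.length) :
    ∃ A M : List α, A.length = j ∧ M.length = ds.length - 2 * j ∧ M.reverse = M ∧
      ds = A ++ (M ++ A.reverse) := by
  have h1 : ds.drop (ds.length - j) = (ds.take j).reverse := by
    have := List.take_reverse (xs := ds) (i := j)
    rw [h] at this
    rw [this, List.reverse_reverse]
  have h2 : ds = ds.take j ++ ((ds.drop j).take (ds.length - 2 * j) ++ (ds.take j).reverse) := by
    conv_lhs => rw [← List.take_append_drop j ds,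
      ← List.take_append_drop (ds.length - 2 * j) (ds.drop j)]
    rw [List.drop_drop, show j + (ds.length - 2 * j) = ds.length - j by omega, h1]
  refine ⟨ds.take j, (ds.drop j).take (ds.length - 2 * j), ?_, ?_, ?_, h2⟩
  · simp; omega
  · simp; omega
  · have h3 := congrArg List.reverse h2
    rw [h, List.reverse_append, List.reverse_append, List.reverse_reverse, List.append_assoc] at h3
    have h4 := List.append_cancel_left (h3.symm.trans h2)
    exact List.append_cancel_right h4

/-- Fixing the length `l` keeps padding zeros, so a value below `b ^ l` determines its digit list
and reversal becomes a function of the value. -/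
theorem Nat.exists_reverse_digit_block {b : ℕ} (hb : 1 < b) (l : ℕ) :
    ∃ ρ : ℕ → ℕ, (∀ r, ρ r < b ^ l) ∧ ∀ B : List ℕ, B.length = l → (∀ x ∈ B, x < b) →
      Nat.ofDigits b B.reverse = ρ (Nat.ofDigits b B) := by
  classical
  refine ⟨fun r => if h : ∃ B : List ℕ, B.length = l ∧ (∀ x ∈ B, x < b) ∧ Nat.ofDigits b B = r
    then Nat.ofDigits b h.choose.reverse else 0, fun r => ?_, fun B hB hBb => ?_⟩
  · dsimp only
    split_ifs with h
    · have := Nat.ofDigits_lt_base_pow_length hb (l := h.choose.reverse)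
        (fun x hx => h.choose_spec.2.1 x (List.mem_reverse.1 hx))
      rwa [List.length_reverse, h.choose_spec.1] at this
    · positivity
  · have h : ∃ B' : List ℕ, B'.length = l ∧ (∀ x ∈ B', x < b) ∧
        Nat.ofDigits b B' = Nat.ofDigits b B := ⟨B, hB, hBb, rfl⟩
    dsimp only
    rw [dif_pos h]
    rw [Nat.ofDigits_inj_of_len_eq hb (h.choose_spec.1.trans hB.symm) h.choose_spec.2.1 hBb
      h.choose_spec.2.2]

theorem reverse_digits_of_mem_basePalindromes {b n : ℕ} (hb : 1 < b) (hn : n ∈ basePalindromes b) :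
    (Nat.digits b n).reverse = Nat.digits b n := by
  have h2 : n = Nat.ofDigits b (Nat.digits b n).reverse := hn.2
  refine Nat.ofDigits_inj_of_len_eq hb (by simp)
    (fun x hx => Nat.digits_lt_base hb (List.mem_reverse.1 hx))
    (fun x hx => Nat.digits_lt_base hb hx) ?_
  rw [← h2, Nat.ofDigits_digits]

/-- Peel off the outer `k` digits at each end, then the next `l`. Here `σ` carries both outer
blocks, and the palindromic symmetry of the middle block is forgotten. -/
theorem exists_blocks_of_mem_basePalindromes {b : ℕ} (hb : 1 < b) (k l m : ℕ) :
    ∃ ρ σ : ℕ → ℕ, (∀ r, ρ r < b ^ l) ∧ ∀ n ∈ basePalindromes b,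
      (Nat.digits b n).length = 2 * k + 2 * l + m →
      ∃ r₁ < b ^ k, ∃ r₂ < b ^ l, ∃ z < b ^ m,
        n = σ r₁ + b ^ k * (r₂ + b ^ l * (z + b ^ m * ρ r₂)) := by
  obtain ⟨ρ, hρ, hρ'⟩ := Nat.exists_reverse_digit_block hb l
  obtain ⟨ρk, -, hρk'⟩ := Nat.exists_reverse_digit_block hb k
  refine ⟨ρ, fun r => r + b ^ k * (b ^ l * (b ^ m * (b ^ l * ρk r))), hρ, fun n hn hlen => ?_⟩
  have hrev := reverse_digits_of_mem_basePalindromes hb hn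
  obtain ⟨A, M, hA, hM, hMrev, hds⟩ := List.exists_eq_append_of_reverse_eq hrev (j := k) (by omega)
  obtain ⟨B, C, hB, hC, -, hds'⟩ := List.exists_eq_append_of_reverse_eq hMrev (j := l) (by omega)
  have hC' : C.length = m := by omega
  have hdig : ∀ x ∈ Nat.digits b n, x < b := fun x hx => Nat.digits_lt_base hb hx
  rw [hds'] at hds
  rw [hds] at hdig
  have hAb : ∀ x ∈ A, x < b := fun x hx => hdig x (by simp [hx])
  have hBb : ∀ x ∈ B, x < b := fun x hx => hdig x (by simp [hx])
  have hCb : ∀ x ∈ C, x < b := fun x hx => hdig x (by simp [hx])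
  have hlt : ∀ D : List ℕ, (∀ x ∈ D, x < b) → Nat.ofDigits b D < b ^ D.length :=
    fun D hD => Nat.ofDigits_lt_base_pow_length hb hD
  refine ⟨Nat.ofDigits b A, hA ▸ hlt A hAb, Nat.ofDigits b B, hB ▸ hlt B hBb, Nat.ofDigits b C,
    hC' ▸ hlt C hCb, ?_⟩
  rw [← Nat.ofDigits_digits b n, hds]
  simp only [Nat.ofDigits_append, List.length_append, List.length_reverse, hA, hB, hC',
    hρ' B hB hBb, hρk' A hA hAb]
  ring

/-! ### Palindromes of a given length -/

/-- The palindromes with `N` base-`b` digits that are coprime to `b` and divisible by `d ^ 2` for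
some `d` in `[D₀, 2 * D₀]`. -/
def palindromesWithSquareDivisor (b N D₀ : ℕ) : Set ℕ :=
  {n | n ∈ basePalindromes b ∧ (Nat.digits b n).length = N ∧ Nat.Coprime n b ∧
    ∃ d, D₀ ≤ d ∧ d ≤ 2 * D₀ ∧ d ^ 2 ∣ n}

/-- The trivial bound: half of the digits determine a palindrome. -/
theorem ncard_palindromesWithSquareDivisor_le_pow {b : ℕ} (hb : 1 < b) (N D₀ : ℕ) :
    (palindromesWithSquareDivisor b N D₀).ncard ≤ b ^ ((N + 1) / 2) := by
  obtain ⟨ρ, σ, hρ, h⟩ := exists_blocks_of_mem_basePalindromes hb (N / 2) 0 (N % 2)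
  set S := palindromesWithSquareDivisor b N D₀ with hS
  have h' : ∀ n ∈ S, ∃ v : ℕ × ℕ, v.1 < b ^ (N / 2) ∧ v.2 < b ^ (N % 2) ∧
      n = σ v.1 + b ^ (N / 2) * v.2 := by
    intro n hn
    obtain ⟨r₁, hr₁, r₂, hr₂, z, hz, e⟩ := h n hn.1 (by have := hn.2.1; omega)
    refine ⟨(r₁, z), hr₁, hz, ?_⟩
    have h1 : r₂ = 0 := by simpa using hr₂
    have h2 : ρ r₂ = 0 := by simpa using hρ r₂
    rw [e, h2, h1]
    simp
  choose! v hv1 hv2 hv3 using h'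
  have := Set.ncard_le_ncard_of_injOn (s := S)
    (t := ((Finset.range (b ^ (N / 2)) ×ˢ Finset.range (b ^ (N % 2)) : Finset (ℕ × ℕ)) :
      Set (ℕ × ℕ))) v
    (fun n hn => by simpa using ⟨hv1 n hn, hv2 n hn⟩)
    (fun n hn n' hn' e => by rw [hv3 n hn, hv3 n' hn', e]) (Finset.finite_toSet _)
  rw [Set.ncard_coe_finset, Finset.card_product, Finset.card_range, Finset.card_range,
    ← pow_add] at this
  refine this.trans_eq ?_
  congr 1
  omega

theorem ncard_palindromesWithSquareDivisor_le {b : ℕ} (hb : 1 < b) {k e m D₀ : ℕ}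
    (hE : (b ^ e) ^ 4 ≤ D₀) (hm : b ^ e * b ^ m ≤ D₀ ^ 2) :
    (palindromesWithSquareDivisor b (2 * k + 4 * e + m) D₀).ncard ≤
      b ^ k * (96 * (b ^ (2 * e)).divisors.card ^ 2 * b ^ e * D₀) := by
  classical
  obtain ⟨ρ, σ, hρ, h⟩ := exists_blocks_of_mem_basePalindromes hb k (2 * e) m
  set S := palindromesWithSquareDivisor b (2 * k + 4 * e + m) D₀ with hS
  have hb0 : 0 < b := by omega
  have h' : ∀ n ∈ S, ∃ v : ℕ × ℕ × ℕ, v.1 < b ^ k ∧ D₀ ≤ v.2.1 ∧ v.2.1 ≤ 2 * D₀ ∧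
      v.2.2 < b ^ (2 * e) ∧ v.2.1 ^ 2 ∣ n ∧ Nat.Coprime v.2.1 b ∧ ∃ z < b ^ m,
      n = σ v.1 + b ^ k * (v.2.2 + b ^ (2 * e) * (z + b ^ m * ρ v.2.2)) := by
    rintro n ⟨hn, hlen, hcop, d, hd1, hd2, hdvd⟩
    obtain ⟨r₁, hr₁, r₂, hr₂, z, hz, he⟩ := h n hn (by omega)
    exact ⟨(r₁, d, r₂), hr₁, hd1, hd2, hr₂, hdvd,
      hcop.coprime_dvd_left ((dvd_pow_self d two_ne_zero).trans hdvd), z, hz, he⟩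
  choose! v hv1 hv2 hv3 hv4 hv5 hv6 z hz1 hz2 using h'
  set T : ℕ → Finset (ℕ × ℕ) := fun r₁ =>
    {i ∈ Finset.Icc D₀ (2 * D₀) ×ˢ Finset.range (b ^ (2 * e)) | Nat.Coprime i.1 (b ^ k) ∧
      Nat.Coprime i.1 (b ^ (2 * e)) ∧ ∃ z < b ^ m, i.1 ^ 2 ∣
        σ r₁ + b ^ k * (i.2 + b ^ (2 * e) * (z + b ^ m * ρ i.2))} with hT
  have hTcard : ∀ r₁, (T r₁).card ≤ 96 * (b ^ (2 * e)).divisors.card ^ 2 * b ^ e * D₀ := fun r₁ =>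
    card_sq_dvd_le (Nat.one_le_pow _ _ hb0) (by rw [← pow_mul, mul_comm])
      (Nat.one_le_pow _ _ hb0) hE hm hρ
  have hD₀ : 1 ≤ D₀ := le_trans (Nat.one_le_pow _ _ (Nat.pow_pos hb0)) hE
  have := Set.ncard_le_ncard_of_injOn (s := S)
    (t := (((Finset.range (b ^ k)).sigma T : Finset (Σ _ : ℕ, ℕ × ℕ)) : Set (Σ _ : ℕ, ℕ × ℕ)))
    (fun n => ⟨(v n).1, (v n).2⟩)
    (fun n hn => by
      simp only [Finset.coe_sigma, Set.mem_sigma_iff, Finset.mem_coe, Finset.mem_range, hT,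
        Finset.mem_filter, Finset.mem_product, Finset.mem_Icc]
      refine ⟨hv1 n hn, ⟨⟨hv2 n hn, hv3 n hn⟩, hv4 n hn⟩, (hv6 n hn).pow_right _,
        (hv6 n hn).pow_right _, z n, hz1 n hn, ?_⟩
      rw [← hz2 n hn]
      exact hv5 n hn)
    (fun n hn n' hn' he => by
      have hvv : v n = v n' := by
        simp only [Sigma.mk.injEq, heq_eq_eq] at he
        exact Prod.ext he.1 he.2
      have e1 := hz2 n hn
      have e2 := hz2 n' hn'
      have d1 := hv5 n hn
      have d2 := hv5 n' hn'
      rw [← hvv] at e2 d2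
      -- With the same `d`, `r₁` and `r₂`, the difference of the two numbers is `b^(k+2e)` times the
      -- difference of the middle blocks; `d` is coprime to `b`, and both blocks are below `b^m ≤
      -- d²`.
      have hzz : z n ≡ z n' [MOD (v n).2.1 ^ 2] := by
        have hc : Nat.Coprime ((v n).2.1 ^ 2) (b ^ k * b ^ (2 * e)) := by
          rw [← pow_add]
          exact ((hv6 n hn).pow_right _).pow_left 2
        rw [Nat.modEq_iff_dvd]
        have hdiv : (((v n).2.1 ^ 2 : ℕ) : ℤ) ∣ ((b ^ k * b ^ (2 * e) : ℕ) : ℤ) * ((z n' : ℤ) - z n) := by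
          have h3 : (((v n).2.1 ^ 2 : ℕ) : ℤ) ∣ (n' : ℤ) - n :=
            dvd_sub (Int.natCast_dvd_natCast.2 d2) (Int.natCast_dvd_natCast.2 d1)
          have h4 : (n' : ℤ) - n = ((b ^ k * b ^ (2 * e) : ℕ) : ℤ) * ((z n' : ℤ) - z n) := by
            have e1' := congrArg (Nat.cast : ℕ → ℤ) e1
            have e2' := congrArg (Nat.cast : ℕ → ℤ) e2
            push_cast at e1' e2' ⊢
            linear_combination e2' - e1'
          rwa [h4] at h3
        exact (Nat.isCoprime_iff_coprime.2 hc).dvd_of_dvd_mul_left hdiv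
      have hbm : b ^ m ≤ (v n).2.1 ^ 2 := by
        calc b ^ m ≤ b ^ e * b ^ m := Nat.le_mul_of_pos_left _ (Nat.pow_pos hb0)
          _ ≤ D₀ ^ 2 := hm
          _ ≤ _ := Nat.pow_le_pow_left (hv2 n hn) 2
      have hz' : z n = z n' := Nat.ModEq.eq_of_lt_of_lt hzz ((hz1 n hn).trans_le hbm)
        ((hz1 n' hn').trans_le hbm)
      rw [e1, e2, hz'])
    (Finset.finite_toSet _)
  rw [Set.ncard_coe_finset, Finset.card_sigma] at this
  refine this.trans ((Finset.sum_le_sum fun r₁ _ => hTcard r₁).trans_eq ?_)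
  rw [Finset.sum_const, Finset.card_range, smul_eq_mul]

/-! ### Divisor bound and choice of block lengths -/

theorem Nat.card_divisors_pow_le {b : ℕ} (hb : b ≠ 0) (j : ℕ) :
    (b ^ j).divisors.card ≤ (j * b + 1) ^ b := by
  rw [Nat.card_divisors (pow_ne_zero _ hb)]
  have h1 : ∀ p ∈ (b ^ j).primeFactors, (b ^ j).factorization p + 1 ≤ j * b + 1 := by
    intro p _
    rw [Nat.factorization_pow, Finsupp.smul_apply, smul_eq_mul]
    have := Nat.factorization_lt p hb
    gcongr
  refine (Finset.prod_le_pow_card _ _ _ h1).trans (Nat.pow_le_pow_right (by omega) ?_)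
  have hsub : (b ^ j).primeFactors ⊆ Finset.Icc 1 b := by
    intro p hp
    have hp' := Nat.prime_of_mem_primeFactors hp
    exact Finset.mem_Icc.2 ⟨hp'.one_le, Nat.le_of_dvd (Nat.pos_of_ne_zero hb)
      (hp'.dvd_of_dvd_pow (Nat.dvd_of_mem_primeFactors hp))⟩
  simpa using Finset.card_le_card hsub

theorem exists_sq_card_divisors_pow_le {b : ℕ} (hb : b ≠ 0) {q : ℝ} (hq : 1 < q) :
    ∃ C : ℝ, 0 ≤ C ∧ ∀ e : ℕ, ((b ^ (2 * e)).divisors.card : ℝ) ^ 2 ≤ C * q ^ e := by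
  obtain ⟨A, hA⟩ := (tendsto_pow_const_div_const_pow_of_one_lt (2 * b) hq).bddAbove_range
  have hA' : ∀ n : ℕ, (n : ℝ) ^ (2 * b) ≤ A * q ^ n := by
    intro n
    have h := hA ⟨n, rfl⟩
    have hpos : 0 < q ^ n := by positivity
    rwa [div_le_iff₀ hpos] at h
  have hA0 : 0 ≤ A := by
    have := hA' 1
    norm_num at this
    nlinarith
  refine ⟨((2 * b + 1 : ℕ) : ℝ) ^ (2 * b) * A * q, by positivity, fun e => ?_⟩
  have h1 : ((b ^ (2 * e)).divisors.card) ^ 2 ≤ (2 * b + 1) ^ (2 * b) * (e + 1) ^ (2 * b) := by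
    calc ((b ^ (2 * e)).divisors.card) ^ 2 ≤ ((2 * e * b + 1) ^ b) ^ 2 :=
          Nat.pow_le_pow_left (Nat.card_divisors_pow_le hb _) 2
      _ = (2 * e * b + 1) ^ (2 * b) := by rw [← pow_mul, mul_comm b 2]
      _ ≤ ((2 * b + 1) * (e + 1)) ^ (2 * b) := Nat.pow_le_pow_left (by nlinarith) _
      _ = _ := mul_pow _ _ _
  calc ((b ^ (2 * e)).divisors.card : ℝ) ^ 2
      ≤ ((2 * b + 1 : ℕ) : ℝ) ^ (2 * b) * ((e + 1 : ℕ) : ℝ) ^ (2 * b) := by exact_mod_cast h1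
    _ ≤ ((2 * b + 1 : ℕ) : ℝ) ^ (2 * b) * (A * q ^ (e + 1)) := by gcongr; exact hA' (e + 1)
    _ = _ := by ring

/-- Here `q = b^(1/4)`, so `(q ^ N) ^ 2 = b^(N/2)` is the trivial size. The first term carries the
saving; the second covers numbers too short for the desired blocks. -/
theorem exists_ncard_palindromesWithSquareDivisor_le {b : ℕ} (hb : 1 < b) {q : ℝ} (hq : 1 < q)
    (hqb : q ^ 4 = b) :
    ∃ C : ℝ, 0 ≤ C ∧ ∀ N D₀ : ℕ, 1 ≤ D₀ →
      ((palindromesWithSquareDivisor b N D₀).ncard : ℝ) ≤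
        C * ((q ^ N) ^ 2 * (D₀ : ℝ) ^ (-(1 / 16) : ℝ) + q ^ N * (D₀ : ℝ) ^ (11 / 16 : ℝ)) := by
  obtain ⟨C₁, hC₁, hτ⟩ := exists_sq_card_divisors_pow_le (b := b) (by omega) hq
  have hb0 : 0 < b := by omega
  have hq0 : 0 < q := by linarith
  refine ⟨96 * C₁ * b * q + q ^ 2 + q ^ 2 * b, by positivity, fun N D₀ hD₀ => ?_⟩
  set y : ℝ := (D₀ : ℝ) with hy
  set T : ℝ := q ^ N with hT
  have hT0 : 0 < T := by positivity
  have hy1 : 1 ≤ y := by rw [hy]; exact_mod_cast hD₀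
  have hy0 : 0 < y := by linarith
  have hT4 : T ^ 4 = (b : ℝ) ^ N := by rw [hT, ← hqb, ← pow_mul, ← pow_mul, mul_comm]
  have hu : 0 < y ^ (-(1 / 16) : ℝ) := Real.rpow_pos_of_pos hy0 _
  have hv : 0 < y ^ (11 / 16 : ℝ) := Real.rpow_pos_of_pos hy0 _
  have htriv : ((palindromesWithSquareDivisor b N D₀).ncard : ℝ) ≤ q ^ 2 * T ^ 2 := by
    have h1 : ((palindromesWithSquareDivisor b N D₀).ncard : ℝ) ≤ (b : ℝ) ^ ((N + 1) / 2) := by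
      exact_mod_cast ncard_palindromesWithSquareDivisor_le_pow hb N D₀
    refine h1.trans ?_
    rw [← hqb, ← pow_mul, hT, ← pow_mul, ← pow_add]
    exact pow_le_pow_right₀ hq.le (by omega)
  suffices h : ((palindromesWithSquareDivisor b N D₀).ncard : ℝ) ≤
      96 * C₁ * b * q * (T ^ 2 * y ^ (-(1 / 16) : ℝ)) ∨
      ((palindromesWithSquareDivisor b N D₀).ncard : ℝ) ≤ q ^ 2 * (T * y ^ (11 / 16 : ℝ)) ∨
      ((palindromesWithSquareDivisor b N D₀).ncard : ℝ) ≤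
        q ^ 2 * b * (T ^ 2 * y ^ (-(1 / 16) : ℝ)) by
    have p1 : 0 ≤ 96 * C₁ * b * q * (T ^ 2 * y ^ (-(1 / 16) : ℝ)) := by positivity
    have p2 : 0 ≤ 96 * C₁ * b * q * (T * y ^ (11 / 16 : ℝ)) := by positivity
    have p3 : 0 ≤ q ^ 2 * (T ^ 2 * y ^ (-(1 / 16) : ℝ)) := by positivity
    have p4 : 0 ≤ q ^ 2 * (T * y ^ (11 / 16 : ℝ)) := by positivity
    have p5 : 0 ≤ q ^ 2 * b * (T ^ 2 * y ^ (-(1 / 16) : ℝ)) := by positivity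
    have p6 : 0 ≤ q ^ 2 * b * (T * y ^ (11 / 16 : ℝ)) := by positivity
    rcases h with h | h | h <;> linarith
  by_cases hDb : D₀ < b
  · right; right
    refine htriv.trans ?_
    have h1 : 1 ≤ (b : ℝ) * y ^ (-(1 / 16) : ℝ) := by
      rw [Real.rpow_neg hy0.le, ← div_eq_mul_inv, one_le_div (Real.rpow_pos_of_pos hy0 _)]
      calc y ^ (1 / 16 : ℝ) ≤ y ^ (1 : ℝ) := Real.rpow_le_rpow_of_exponent_le hy1 (by norm_num)
        _ = y := Real.rpow_one y
        _ ≤ b := by rw [hy]; exact_mod_cast hDb.le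
    calc q ^ 2 * T ^ 2 ≤ q ^ 2 * T ^ 2 * ((b : ℝ) * y ^ (-(1 / 16) : ℝ)) :=
          le_mul_of_one_le_right (by positivity) h1
      _ = _ := by ring
  push Not at hDb
  -- The largest `E = b^e` with `E⁴ ≤ D₀`, the constraint that makes short intervals of `d` at least
  -- as long as `L`.
  set e := Nat.log b D₀ / 4 with he
  have hE1 : (b ^ e) ^ 4 ≤ D₀ := by
    rw [← pow_mul]
    exact (Nat.pow_le_pow_right hb0 (by omega)).trans (Nat.pow_log_le_self b (by omega))
  have hE2 : D₀ < (b * b ^ e) ^ 4 := by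
    rw [← pow_succ', ← pow_mul]
    exact (Nat.lt_pow_succ_log_self hb D₀).trans_le (Nat.pow_le_pow_right hb0 (by omega))
  have hEpos : 0 < b ^ e := Nat.pow_pos hb0
  have hED : b ^ e ≤ D₀ := (Nat.le_self_pow (by norm_num) _).trans hE1
  -- The longest middle block with `E Z ≤ D₀²`.
  set m₀ := Nat.log b (D₀ ^ 2 / b ^ e) with hm₀
  have hquot : b ≤ D₀ ^ 2 / b ^ e := by
    rw [Nat.le_div_iff_mul_le hEpos, sq]
    exact Nat.mul_le_mul hDb hED
  have hm1 : 1 ≤ m₀ := Nat.log_pos hb hquot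
  have hm2 : b ^ e * b ^ m₀ ≤ D₀ ^ 2 := by
    rw [mul_comm, ← Nat.le_div_iff_mul_le hEpos]
    exact Nat.pow_log_le_self b (by omega)
  have hm3 : D₀ ^ 2 < b ^ (m₀ + 1) * b ^ e := by
    rw [← Nat.div_lt_iff_lt_mul hEpos]
    exact Nat.lt_pow_succ_log_self hb _
  by_cases hN : N < 4 * e + m₀
  · right; left
    refine htriv.trans ?_
    have h1 : b ^ N ≤ (b ^ e) ^ 3 * D₀ ^ 2 := by
      calc b ^ N ≤ b ^ (4 * e + m₀) := Nat.pow_le_pow_right hb0 hN.le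
        _ = (b ^ e) ^ 3 * (b ^ e * b ^ m₀) := by rw [pow_add, mul_comm 4 e, pow_mul]; ring
        _ ≤ _ := Nat.mul_le_mul_left _ hm2
    have h2 : ((b : ℝ) ^ e) ≤ y ^ (1 / 4 : ℝ) := by
      have h3 : ((b : ℝ) ^ e) ^ (4 : ℕ) ≤ y := by rw [hy]; exact_mod_cast hE1
      calc (b : ℝ) ^ e = (((b : ℝ) ^ e) ^ (4 : ℕ)) ^ (1 / 4 : ℝ) := by
            rw [← Real.rpow_natCast ((b : ℝ) ^ e) 4, ← Real.rpow_mul (by positivity)]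
            norm_num
        _ ≤ _ := Real.rpow_le_rpow (by positivity) h3 (by norm_num)
    have h3 : T ≤ y ^ (11 / 16 : ℝ) := by
      rw [← pow_le_pow_iff_left₀ hT0.le hv.le (n := 4) (by norm_num), hT4]
      calc (b : ℝ) ^ N ≤ ((b : ℝ) ^ e) ^ 3 * y ^ 2 := by rw [hy]; exact_mod_cast h1
        _ ≤ (y ^ (1 / 4 : ℝ)) ^ 3 * y ^ 2 := by gcongr
        _ = (y ^ (11 / 16 : ℝ)) ^ 4 := by
            rw [← Real.rpow_mul_natCast hy0.le, ← Real.rpow_mul_natCast hy0.le,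
              ← Real.rpow_natCast y 2, ← Real.rpow_add hy0]
            norm_num
    calc q ^ 2 * T ^ 2 = q ^ 2 * (T * T) := by ring
      _ ≤ _ := by gcongr
  · left
    -- Parity: `N - 4e - m` must be even, so `m` may have to be one less than `m₀`.
    obtain ⟨k, m, hkm, hmm, hmm'⟩ : ∃ k m : ℕ, N = 2 * k + 4 * e + m ∧ m ≤ m₀ ∧ m₀ ≤ m + 1 := by
      rcases Nat.even_or_odd' (N - (4 * e + m₀)) with ⟨c, hc | hc⟩
      · exact ⟨c, m₀, by omega, by omega, by omega⟩
      · exact ⟨c + 1, m₀ - 1, by omega, by omega, by omega⟩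
    have hm4 : b ^ e * b ^ m ≤ D₀ ^ 2 :=
      (Nat.mul_le_mul_left _ (Nat.pow_le_pow_right hb0 hmm)).trans hm2
    have hm5 : D₀ ^ 2 ≤ b ^ 2 * (b ^ e * b ^ m) := by
      refine hm3.le.trans ?_
      calc b ^ (m₀ + 1) * b ^ e ≤ b ^ (m + 2) * b ^ e :=
            Nat.mul_le_mul_right _ (Nat.pow_le_pow_right hb0 (by omega))
        _ = _ := by rw [pow_add]; ring
    have h1 := ncard_palindromesWithSquareDivisor_le hb (k := k) hE1 hm4
    rw [← hkm] at h1
    set w : ℝ := q ^ e with hw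
    have hw0 : 0 < w := by positivity
    have hw4 : (b : ℝ) ^ e = w ^ 4 := by rw [hw, ← hqb, ← pow_mul, ← pow_mul, mul_comm]
    -- With `w = E^(1/4)`, this says that `b^k E D₀` is at most `b T² w⁻²`. One factor `w` pays for
    -- the squared divisor count; the other is about `D₀^(1/16)`.
    have h2 : (b : ℝ) ^ k * w ^ 4 * y * w ^ 2 ≤ b * T ^ 2 := by
      rw [← pow_le_pow_iff_left₀ (by positivity) (by positivity) (n := 2) (by norm_num)]
      have h3 : y ^ 2 ≤ (b : ℝ) ^ 2 * (w ^ 4 * (b : ℝ) ^ m) := by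
        rw [← hw4, hy]; exact_mod_cast hm5
      have h4 : T ^ 4 = ((b : ℝ) ^ k) ^ 2 * w ^ 16 * (b : ℝ) ^ m := by
        rw [hT4, hkm, pow_add, pow_add, mul_comm 2 k, mul_comm 4 e, pow_mul, pow_mul, hw4]
        ring
      calc ((b : ℝ) ^ k * w ^ 4 * y * w ^ 2) ^ 2 = ((b : ℝ) ^ k) ^ 2 * w ^ 12 * y ^ 2 := by ring
        _ ≤ ((b : ℝ) ^ k) ^ 2 * w ^ 12 * ((b : ℝ) ^ 2 * (w ^ 4 * (b : ℝ) ^ m)) := by gcongr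
        _ = (b : ℝ) ^ 2 * (((b : ℝ) ^ k) ^ 2 * w ^ 16 * (b : ℝ) ^ m) := by ring
        _ = (b * T ^ 2) ^ 2 := by rw [← h4]; ring
    have h5 : y ^ (1 / 16 : ℝ) ≤ q * w := by
      have : y ≤ (q * w) ^ (16 : ℕ) := by
        have h6 : y ≤ (b * (b : ℝ) ^ e) ^ 4 := by rw [hy]; exact_mod_cast hE2.le
        refine h6.trans_eq ?_
        rw [hw4, ← hqb]; ring
      calc y ^ (1 / 16 : ℝ) ≤ ((q * w) ^ (16 : ℕ)) ^ (1 / 16 : ℝ) :=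
            Real.rpow_le_rpow hy0.le this (by norm_num)
        _ = q * w := by
            rw [← Real.rpow_natCast, ← Real.rpow_mul (by positivity)]
            norm_num
    have h7 : 1 ≤ q * w * y ^ (-(1 / 16) : ℝ) := by
      rw [Real.rpow_neg hy0.le, ← div_eq_mul_inv, one_le_div (Real.rpow_pos_of_pos hy0 _)]
      exact h5
    calc ((palindromesWithSquareDivisor b N D₀).ncard : ℝ)
        ≤ (b : ℝ) ^ k * (96 * ((b ^ (2 * e)).divisors.card : ℝ) ^ 2 * (b : ℝ) ^ e * y) := by
          rw [hy]; exact_mod_cast h1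
      _ ≤ (b : ℝ) ^ k * (96 * (C₁ * w) * (b : ℝ) ^ e * y) := by
          have := hτ e
          gcongr
      _ = 96 * C₁ * ((b : ℝ) ^ k * w ^ 4 * y * w ^ 2) * w⁻¹ := by
          rw [hw4]; field_simp
      _ ≤ 96 * C₁ * (b * T ^ 2) * w⁻¹ := by gcongr
      _ ≤ 96 * C₁ * (b * T ^ 2) * w⁻¹ * (q * w * y ^ (-(1 / 16) : ℝ)) :=
          le_mul_of_one_le_right (by positivity) h7
      _ = _ := by field_simp

/-! ### Summation over lengths and the final exponents -/

theorem exists_palindromeSquareCount_le {b : ℕ} (hb : 1 < b) :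
    ∃ C : ℝ, 0 ≤ C ∧ ∀ x D : ℝ, 1 ≤ x → 1 ≤ D → D ≤ x ^ (1 / 3 : ℝ) →
      (palindromeSquareCount b x D : ℝ) ≤ C * (x ^ (1 / 2 : ℝ) * D ^ (-(1 / 16) : ℝ)) := by
  have hb' : (1 : ℝ) < b := by exact_mod_cast hb
  have hb0 : (0 : ℝ) < b := by linarith
  set q : ℝ := (b : ℝ) ^ (1 / 4 : ℝ) with hqdef
  have hq : 1 < q := Real.one_lt_rpow hb' (by norm_num)
  have hqb : q ^ 4 = b := by
    rw [hqdef, ← Real.rpow_mul_natCast hb0.le]; norm_num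
  have hq0 : 0 < q := by linarith
  obtain ⟨C, hC, hP⟩ := exists_ncard_palindromesWithSquareDivisor_le hb hq hqb
  have hgeom : ∀ p : ℝ, 1 < p → ∀ M : ℕ, ∑ N ∈ Finset.range (M + 1), p ^ N ≤ p / (p - 1) * p ^ M := by
    intro p hp M
    rw [geom_sum_eq hp.ne', div_mul_eq_mul_div]
    have : 0 < p - 1 := by linarith
    gcongr
    rw [pow_succ']
    linarith
  have hq2 : 1 < q ^ 2 := one_lt_pow₀ hq (by norm_num)
  have hq2' : 0 < q ^ 2 - 1 := by linarith
  have hq1' : 0 < q - 1 := by linarith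
  refine ⟨C * (q ^ 2 / (q ^ 2 - 1) * q ^ 2 + q / (q - 1) * q * 2), by positivity,
    fun x D hx hD hDx => ?_⟩
  have hx0 : 0 < x := by linarith
  have hD0 : 0 < D := by linarith
  set D₀ := ⌈D⌉₊ with hD₀
  set M := Nat.log b ⌊x⌋₊ + 1 with hM
  have hD₀1 : 1 ≤ D₀ := Nat.one_le_ceil_iff.2 hD0
  have hDle : D ≤ D₀ := Nat.le_ceil D
  have hDle2 : (D₀ : ℝ) ≤ 2 * D := by
    have := Nat.ceil_lt_add_one hD0.le
    linarith
  have hfl : 1 ≤ ⌊x⌋₊ := Nat.le_floor (by simpa using hx)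
  have hsub : {n | n ∈ coprimePalindromesUpTo b x ∧
      ∃ d : ℕ, D ≤ (d : ℝ) ∧ (d : ℝ) ≤ 2 * D ∧ d ^ 2 ∣ n} ⊆
      ⋃ N ∈ Finset.range (M + 1), {n | n ∈ palindromesWithSquareDivisor b N D₀ ∧ n ≤ ⌊x⌋₊} := by
    rintro n ⟨⟨hn, hnx, hcop⟩, d, hd1, hd2, hdvd⟩
    have hnfl : n ≤ ⌊x⌋₊ := Nat.le_floor hnx
    have hn0 : n ≠ 0 := by rintro rfl; exact hn.1 (dvd_zero b)
    simp only [Set.mem_iUnion, Finset.mem_range, exists_prop]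
    refine ⟨(Nat.digits b n).length, ?_, ⟨hn, rfl, ?_, d, Nat.ceil_le.2 hd1, ?_, hdvd⟩, hnfl⟩
    · rw [Nat.length_digits b n hb hn0]
      have := Nat.log_mono_right (b := b) hnfl
      omega
    · exact hcop.coprime_dvd_right (Nat.dvd_sub (dvd_pow_self b (by norm_num)) dvd_rfl)
    · have : (d : ℝ) ≤ 2 * D₀ := by linarith
      exact_mod_cast this
  have hcard : (palindromeSquareCount b x D : ℝ) ≤
      ∑ N ∈ Finset.range (M + 1), ((palindromesWithSquareDivisor b N D₀).ncard : ℝ) := by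
    have hfin : ∀ N, {n | n ∈ palindromesWithSquareDivisor b N D₀}.Finite := fun N =>
      (Set.finite_Iio (b ^ N)).subset fun n hn => by
        have := Nat.lt_base_pow_length_digits (b := b) (m := n) hb
        rwa [hn.2.1] at this
    have h1 := (Set.ncard_le_ncard hsub (Set.Finite.biUnion (Finset.finite_toSet _)
      fun N _ => (hfin N).subset fun n hn => hn.1)).trans (Finset.set_ncard_biUnion_le _ _)
    have h2 := h1.trans (Finset.sum_le_sum fun N _ =>
      Set.ncard_le_ncard (fun n hn => hn.1) (hfin N))
    exact_mod_cast h2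
  have hqM : q ^ M ≤ q * x ^ (1 / 4 : ℝ) := by
    rw [← pow_le_pow_iff_left₀ (by positivity) (by positivity) (n := 4) (by norm_num), mul_pow,
      ← Real.rpow_mul_natCast hx0.le, ← pow_mul, mul_comm M, pow_mul, hqb]
    norm_num
    have h1 : b ^ Nat.log b ⌊x⌋₊ ≤ ⌊x⌋₊ := Nat.pow_log_le_self b (by omega)
    have h2 : (b : ℝ) ^ Nat.log b ⌊x⌋₊ ≤ x :=
      (show (b : ℝ) ^ Nat.log b ⌊x⌋₊ ≤ ⌊x⌋₊ by exact_mod_cast h1).trans (Nat.floor_le hx0.le)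
    rw [hM, pow_succ']
    gcongr
  have hqM2 : (q ^ 2) ^ M ≤ q ^ 2 * x ^ (1 / 2 : ℝ) := by
    calc (q ^ 2) ^ M = (q ^ M) ^ 2 := by rw [← pow_mul, ← pow_mul, mul_comm]
      _ ≤ (q * x ^ (1 / 4 : ℝ)) ^ 2 := by gcongr
      _ = _ := by rw [mul_pow, ← Real.rpow_mul_natCast hx0.le]; norm_num
  have hu : (D₀ : ℝ) ^ (-(1 / 16) : ℝ) ≤ D ^ (-(1 / 16) : ℝ) :=
    Real.rpow_le_rpow_of_nonpos hD0 hDle (by norm_num)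
  have hv : (D₀ : ℝ) ^ (11 / 16 : ℝ) ≤ 2 * D ^ (11 / 16 : ℝ) := by
    calc (D₀ : ℝ) ^ (11 / 16 : ℝ) ≤ (2 * D) ^ (11 / 16 : ℝ) :=
          Real.rpow_le_rpow (by positivity) hDle2 (by norm_num)
      _ = 2 ^ (11 / 16 : ℝ) * D ^ (11 / 16 : ℝ) := Real.mul_rpow (by norm_num) hD0.le
      _ ≤ 2 ^ (1 : ℝ) * D ^ (11 / 16 : ℝ) := by gcongr <;> norm_num
      _ = _ := by rw [Real.rpow_one]
  -- The short-length term is absorbed by the main one exactly when `D^(3/4) ≤ x^(1/4)`, whence the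
  -- range `D ≤ x^(1/3)`.
  have hxD : x ^ (1 / 4 : ℝ) * D ^ (11 / 16 : ℝ) ≤ x ^ (1 / 2 : ℝ) * D ^ (-(1 / 16) : ℝ) := by
    have h1 : D ^ (3 / 4 : ℝ) ≤ x ^ (1 / 4 : ℝ) := by
      calc D ^ (3 / 4 : ℝ) ≤ (x ^ (1 / 3 : ℝ)) ^ (3 / 4 : ℝ) :=
            Real.rpow_le_rpow hD0.le hDx (by norm_num)
        _ = _ := by rw [← Real.rpow_mul hx0.le]; norm_num
    calc x ^ (1 / 4 : ℝ) * D ^ (11 / 16 : ℝ)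
        = x ^ (1 / 4 : ℝ) * (D ^ (3 / 4 : ℝ) * D ^ (-(1 / 16) : ℝ)) := by
          rw [← Real.rpow_add hD0]; norm_num
      _ ≤ x ^ (1 / 4 : ℝ) * (x ^ (1 / 4 : ℝ) * D ^ (-(1 / 16) : ℝ)) := by gcongr
      _ = _ := by rw [← mul_assoc, ← Real.rpow_add hx0]; norm_num
  calc (palindromeSquareCount b x D : ℝ)
      ≤ ∑ N ∈ Finset.range (M + 1), C * ((q ^ N) ^ 2 * (D₀ : ℝ) ^ (-(1 / 16) : ℝ) +
          q ^ N * (D₀ : ℝ) ^ (11 / 16 : ℝ)) :=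
        hcard.trans (Finset.sum_le_sum fun N _ => hP N D₀ hD₀1)
    _ = C * ((∑ N ∈ Finset.range (M + 1), (q ^ 2) ^ N) * (D₀ : ℝ) ^ (-(1 / 16) : ℝ) +
          (∑ N ∈ Finset.range (M + 1), q ^ N) * (D₀ : ℝ) ^ (11 / 16 : ℝ)) := by
        rw [← Finset.mul_sum, Finset.sum_add_distrib, Finset.sum_mul, Finset.sum_mul]
        simp_rw [← pow_mul, mul_comm]
    _ ≤ C * ((q ^ 2 / (q ^ 2 - 1) * (q ^ 2 * x ^ (1 / 2 : ℝ))) * D ^ (-(1 / 16) : ℝ) +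
          (q / (q - 1) * (q * x ^ (1 / 4 : ℝ))) * (2 * D ^ (11 / 16 : ℝ))) := by
        have h1 := (hgeom (q ^ 2) hq2 M).trans
          (mul_le_mul_of_nonneg_left hqM2 (by positivity))
        have h2 := (hgeom q hq M).trans (mul_le_mul_of_nonneg_left hqM (by positivity))
        gcongr
    _ = C * (q ^ 2 / (q ^ 2 - 1) * q ^ 2 * (x ^ (1 / 2 : ℝ) * D ^ (-(1 / 16) : ℝ)) +
          q / (q - 1) * q * 2 * (x ^ (1 / 4 : ℝ) * D ^ (11 / 16 : ℝ))) := by ring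
    _ ≤ C * (q ^ 2 / (q ^ 2 - 1) * q ^ 2 * (x ^ (1 / 2 : ℝ) * D ^ (-(1 / 16) : ℝ)) +
          q / (q - 1) * q * 2 * (x ^ (1 / 2 : ℝ) * D ^ (-(1 / 16) : ℝ))) := by gcongr
    _ = _ := by ring

theorem proposition2p4 (b : ℕ) (hb : 2 ≤ b) :
    (∀ ε : ℝ, 0 < ε → ∃ C : ℝ, ∀ x D : ℝ, 0 < x →
      x ^ (3 / 13 : ℝ) ≤ D → D ≤ x ^ (8 / 31 - ε : ℝ) →
        (palindromeSquareCount b x D : ℝ) ≤ C * (x ^ (7 / 11 : ℝ) / D ^ (13 / 22 - ε : ℝ))) ∧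
    (∀ ε : ℝ, 0 < ε → ε < 1 / 10 → ∃ C : ℝ, ∀ x D : ℝ, 0 < x →
      x ^ (3 / 13 + 3 * ε : ℝ) ≤ D → D ≤ x ^ (8 / 31 - ε : ℝ) →
        (palindromeSquareCount b x D : ℝ) ≤ C * x ^ (1 / 2 - ε : ℝ)) := by
  obtain ⟨C, hC, hmain⟩ := exists_palindromeSquareCount_le (b := b) (by omega)
  have hsmall : ∀ x D : ℝ, x < 1 → palindromeSquareCount b x D = 0 := by
    intro x D hx
    rw [palindromeSquareCount, Set.ncard_eq_zero
      ((coprimePalindromesUpTo_finite b x).subset fun _ h => h.1), Set.eq_empty_iff_forall_notMem]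
    rintro n ⟨⟨hn, hnx, -⟩, -⟩
    have hn0 : n = 0 := by
      have : (n : ℝ) < 1 := lt_of_le_of_lt hnx hx
      exact Nat.lt_one_iff.1 (by exact_mod_cast this)
    exact hn.1 (hn0 ▸ dvd_zero b)
  have key : ∀ x D : ℝ, 1 ≤ x → 1 ≤ D → D ≤ x ^ (8 / 31 : ℝ) →
      (palindromeSquareCount b x D : ℝ) ≤ C * (x ^ (7 / 11 : ℝ) * D ^ (-(13 / 22) : ℝ)) := by
    intro x D hx hD hDx
    have hx0 : 0 < x := by linarith
    have hD0 : 0 < D := by linarith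
    refine (hmain x D hx hD
      (hDx.trans (Real.rpow_le_rpow_of_exponent_le hx (by norm_num)))).trans ?_
    refine mul_le_mul_of_nonneg_left ?_ hC
    -- Here `93/176 = 13/22 - 1/16` and `3/22 = 7/11 - 1/2`; their quotient is the endpoint exponent
    -- `8/31`.
    have h1 : D ^ (93 / 176 : ℝ) ≤ x ^ (3 / 22 : ℝ) := by
      calc D ^ (93 / 176 : ℝ) ≤ (x ^ (8 / 31 : ℝ)) ^ (93 / 176 : ℝ) :=
            Real.rpow_le_rpow hD0.le hDx (by norm_num)
        _ = x ^ (3 / 22 : ℝ) := by rw [← Real.rpow_mul hx0.le]; norm_num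
    calc x ^ (1 / 2 : ℝ) * D ^ (-(1 / 16) : ℝ)
        = x ^ (1 / 2 : ℝ) * D ^ (-(13 / 22) : ℝ) * D ^ (93 / 176 : ℝ) := by
          rw [mul_assoc, ← Real.rpow_add hD0]; norm_num
      _ ≤ x ^ (1 / 2 : ℝ) * D ^ (-(13 / 22) : ℝ) * x ^ (3 / 22 : ℝ) := by gcongr
      _ = x ^ (7 / 11 : ℝ) * D ^ (-(13 / 22) : ℝ) := by
          rw [mul_right_comm, ← Real.rpow_add hx0]; norm_num
  refine ⟨fun ε hε => ⟨C, fun x D hx hxD hDx => ?_⟩, fun ε hε _ => ⟨C, fun x D hx hxD hDx => ?_⟩⟩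
  · have hD0 : 0 < D := (Real.rpow_pos_of_pos hx _).trans_le hxD
    rcases lt_or_ge x 1 with hx1 | hx1
    · rw [hsmall x D hx1, Nat.cast_zero]
      positivity
    have hD1 : 1 ≤ D := (Real.one_le_rpow hx1 (by norm_num)).trans hxD
    refine (key x D hx1 hD1
      (hDx.trans (Real.rpow_le_rpow_of_exponent_le hx1 (by linarith)))).trans ?_
    rw [div_eq_mul_inv (x ^ (7 / 11 : ℝ)), ← Real.rpow_neg hD0.le]
    have := Real.rpow_le_rpow_of_exponent_le hD1 (show -(13 / 22) ≤ -(13 / 22 - ε) by linarith)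
    gcongr
  · have hD0 : 0 < D := (Real.rpow_pos_of_pos hx _).trans_le hxD
    rcases lt_or_ge x 1 with hx1 | hx1
    · rw [hsmall x D hx1, Nat.cast_zero]
      positivity
    have hD1 : 1 ≤ D := (Real.one_le_rpow hx1 (by positivity)).trans hxD
    refine (key x D hx1 hD1
      (hDx.trans (Real.rpow_le_rpow_of_exponent_le hx1 (by linarith)))).trans ?_
    refine mul_le_mul_of_nonneg_left ?_ hC
    calc x ^ (7 / 11 : ℝ) * D ^ (-(13 / 22) : ℝ)
        ≤ x ^ (7 / 11 : ℝ) * (x ^ (3 / 13 + 3 * ε : ℝ)) ^ (-(13 / 22) : ℝ) := by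
          refine mul_le_mul_of_nonneg_left ?_ (by positivity)
          exact Real.rpow_le_rpow_of_nonpos (Real.rpow_pos_of_pos hx _) hxD (by norm_num)
      _ = x ^ (7 / 11 + (3 / 13 + 3 * ε) * (-(13 / 22)) : ℝ) := by
          rw [← Real.rpow_mul hx.le, ← Real.rpow_add hx]
      -- The exponent equals `1/2 - (39/22) ε`.
      _ ≤ x ^ (1 / 2 - ε : ℝ) := Real.rpow_le_rpow_of_exponent_le hx1 (by linarith)
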